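/- Let $\lambda\in\{2,3\}$. Then any positive perfect square $m$ (that is, $m=k^2$ for some positive integer $k$) can be written as $m=x^2+y^2+z^2+w^2$ with $x,y,z,w\in\mathbb{N}=\{0,1,2,\ldots\}$ such that $x+2y+\lambda z$ is a positive perfect square. -/

import Mathlib

/-! Writing the root of `m` as `c ^ 2 * k` with `k` squarefree, a representation of `k ^ 2` whose
linear form is `s ^ 2` scales by `c ^ 2` to one of `m` whose linear form is `(c * s) ^ 2`. So `k`
may be taken squarefree; in particular `4 ∤ k`.

Put `S = s ^ 2` and `N = 1 + 2 ^ 2 + lam ^ 2`, which is 9 or 14. Projecting `(x, y, z)` on `(1, 2,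
lam)` and on its orthogonal complement shows that `N * k ^ 2 - S ^ 2` must be a sum of three
squares. Conversely, when it is one, congruences modulo `N` allow the signs and the order of the
three squares to be chosen so that integers `x, y, z, w` come out (`exists_int_rep_two_of_not_dvd`,
`exists_int_rep_two_of_dvd`, `exists_int_rep_three`). If moreover `(N - 1) * k ^ 2 ≤ S ^ 2`,
Cauchy–Schwarz makes `x, y, z` nonnegative (`exists_nat_rep_of_int_rep`).

With suitable parity of `s`, the number `N * k ^ 2 - s ^ 4` is 1 or 2 modulo 4, or four times such a
number. These are sums of three squares, by Dirichlet's theorem on primes, quadratic reciprocity and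
reduction of ternary forms of determinant one. A suitable even `s` with `(N - 1) * k ^ 2 ≤ s ^ 4 ≤ N
* k ^ 2` exists for all large `k`; the remaining `k` are settled by computation. -/

theorem Int.exists_abs_two_mul_add_le (m : ℤ) {g : ℤ} (hg : 0 < g) :
    ∃ t : ℤ, |2 * (m + t * g)| ≤ g := by
  refine ⟨-((2 * m + g) / (2 * g)), ?_⟩
  have h1 := Int.emod_add_mul_ediv (2 * m + g) (2 * g)
  have h2 := Int.emod_nonneg (2 * m + g) (show 2 * g ≠ 0 by omega)
  have h3 := Int.emod_lt_of_pos (2 * m + g) (show 0 < 2 * g by omega)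
  rw [abs_le]
  constructor <;> nlinarith

/-! ### Reduction of positive definite ternary forms of determinant one -/

/-- The integer `n` is a sum of three integer squares. -/
def IsSumThreeSq (n : ℤ) : Prop := ∃ u v w : ℤ, n = u ^ 2 + v ^ 2 + w ^ 2

/-- The ternary quadratic form with Gram matrix `!![a, f, e; f, b, d; e, d, c]`. -/
def ternaryForm (a b c d e f x y z : ℤ) : ℤ :=
  a * x ^ 2 + b * y ^ 2 + c * z ^ 2 + 2 * d * y * z + 2 * e * x * z + 2 * f * x * y

/-- The determinant of the Gram matrix of `ternaryForm`. -/
def ternaryDet (a b c d e f : ℤ) : ℤ :=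
  a * b * c + 2 * d * e * f - a * d ^ 2 - b * e ^ 2 - c * f ^ 2

theorem ternary_minor_identity (a b c d e f : ℤ) :
    (a * b - f ^ 2) * (a * c - e ^ 2) = a * ternaryDet a b c d e f + (a * d - e * f) ^ 2 := by
  unfold ternaryDet; ring

/-- A reduced positive definite ternary form of determinant one is the standard one, up to a
translation. -/
theorem isSumThreeSq_of_reduced {a b c d e f : ℤ} (ha : 0 < a) (hg : 0 < a * b - f ^ 2)
    (hdet : ternaryDet a b c d e f = 1) (h1 : |2 * (a * d - e * f)| ≤ a * b - f ^ 2)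
    (h2 : a * b - f ^ 2 ≤ a * c - e ^ 2) (h3 : |2 * f| ≤ a) (h4 : a ≤ b) (x y z : ℤ) :
    IsSumThreeSq (ternaryForm a b c d e f x y z) := by
  have hid := ternary_minor_identity a b c d e f
  rw [hdet] at hid
  have h1' : (2 * (a * d - e * f)) ^ 2 ≤ (a * b - f ^ 2) ^ 2 := sq_le_sq' (by
    linarith [(abs_le.1 h1).1]) (abs_le.1 h1).2
  have h3' : (2 * f) ^ 2 ≤ a ^ 2 := sq_le_sq' (by linarith [(abs_le.1 h3).1]) (abs_le.1 h3).2
  obtain ⟨g, hgdef⟩ : ∃ g, g = a * b - f ^ 2 := ⟨_, rfl⟩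
  rw [← hgdef] at hg hid h1 h1' h2
  -- The minor identity gives `g ^ 2 ≤ a + g ^ 2 / 4`, and `a ^ 2 ≤ a * b = g + f ^ 2 ≤ g + a ^ 2 /
  -- 4`. The two resulting bounds together leave only `a = g = 1`.
  have hgg : 3 * g ^ 2 ≤ 4 * a := by nlinarith
  have haa : 3 * a ^ 2 ≤ 4 * g := by nlinarith
  have ha1 : a = 1 := by
    by_contra hne
    have : 2 ≤ a := by omega
    have h5 : 3 * a ≤ 2 * g := by nlinarith
    nlinarith
  subst ha1
  have hg1 : g = 1 := by nlinarith
  have hf : f = 0 := by rw [abs_le] at h3; omega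
  subst hf
  have hb : b = 1 := by linarith
  subst hb
  have hd : d = 0 := by
    rw [hg1, abs_le] at h1; omega
  subst hd
  refine ⟨x + e * z, y, z, ?_⟩
  unfold ternaryDet at hdet
  have hc : c = 1 + e ^ 2 := by linarith
  subst hc
  unfold ternaryForm
  ring

/-- Gauss reduction as a double descent, on `a` and, for fixed `a`, on the minor `a * b - f ^ 2`.
Translating `y` by a multiple of `z` makes `a * d - e * f` small; if the other minor is then
smaller, `y` and `z` are swapped. Otherwise `x` is translated to make `f` small, and `x` and `y` are
swapped if the new `b` is below `a`. When no swap applies the form is reduced. -/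
theorem isSumThreeSq_ternaryForm {a b c d e f : ℤ} (ha : 0 < a) (hg : 0 < a * b - f ^ 2)
    (hdet : ternaryDet a b c d e f = 1) (x y z : ℤ) :
    IsSumThreeSq (ternaryForm a b c d e f x y z) := by
  induction hA : a.toNat using Nat.strong_induction_on generalizing a b c d e f x y z with
  | _ A ihA =>
  induction hG : (a * b - f ^ 2).toNat using Nat.strong_induction_on
    generalizing b c d e f x y z with
  | _ G ihG =>
  obtain ⟨t, ht⟩ := Int.exists_abs_two_mul_add_le (a * d - e * f) hg
  obtain ⟨c', hc'⟩ : ∃ c', c' = c + 2 * t * d + t ^ 2 * b := ⟨_, rfl⟩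
  obtain ⟨d', hd'⟩ : ∃ d', d' = d + t * b := ⟨_, rfl⟩
  obtain ⟨e', he'⟩ : ∃ e', e' = e + t * f := ⟨_, rfl⟩
  have hdet' : ternaryDet a b c' d' e' f = 1 := by
    rw [← hdet, hc', hd', he']; unfold ternaryDet; ring
  have hform : ternaryForm a b c d e f x y z = ternaryForm a b c' d' e' f x (y - t * z) z := by
    rw [hc', hd', he']; unfold ternaryForm; ring
  have hid := ternary_minor_identity a b c' d' e' f
  have h1 : |2 * (a * d' - e' * f)| ≤ a * b - f ^ 2 := by
    convert ht using 2; rw [hd', he']; ring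
  -- The product of the two minors is `a` plus a square, so the second is positive as well.
  have hg' : 0 < a * c' - e' ^ 2 := by
    rw [hdet'] at hid
    refine pos_of_mul_pos_right (a := a * b - f ^ 2) ?_ hg.le
    rw [hid]; positivity
  rw [hform]
  by_cases h2 : a * b - f ^ 2 ≤ a * c' - e' ^ 2
  · obtain ⟨r, hr⟩ := Int.exists_abs_two_mul_add_le f ha
    obtain ⟨f₁, hf₁⟩ : ∃ f₁, f₁ = f + r * a := ⟨_, rfl⟩
    obtain ⟨b₁, hb₁⟩ : ∃ b₁, b₁ = b + 2 * r * f + r ^ 2 * a := ⟨_, rfl⟩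
    obtain ⟨d₁, hd₁⟩ : ∃ d₁, d₁ = d' + r * e' := ⟨_, rfl⟩
    have hdet₁ : ternaryDet a b₁ c' d₁ e' f₁ = 1 := by
      rw [← hdet', hf₁, hb₁, hd₁]; unfold ternaryDet; ring
    have hform₁ (Y : ℤ) : ternaryForm a b c' d' e' f x Y z =
        ternaryForm a b₁ c' d₁ e' f₁ (x - r * Y) Y z := by
      rw [hf₁, hb₁, hd₁]; unfold ternaryForm; ring
    have hgeq : a * b₁ - f₁ ^ 2 = a * b - f ^ 2 := by rw [hf₁, hb₁]; ring
    have hmid : a * d₁ - e' * f₁ = a * d' - e' * f := by rw [hf₁, hd₁]; ring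
    rw [hform₁]
    by_cases h4 : a ≤ b₁
    · exact isSumThreeSq_of_reduced ha (by rwa [hgeq]) hdet₁ (by rwa [hgeq, hmid])
        (by rwa [hgeq]) (by rwa [hf₁]) h4 _ _ _
    · have hb₁pos : 0 < b₁ := by
        refine pos_of_mul_pos_right (a := a) ?_ ha.le
        nlinarith [sq_nonneg f₁]
      have hswap (X Y Z : ℤ) : ternaryForm a b₁ c' d₁ e' f₁ X Y Z =
          ternaryForm b₁ a c' e' d₁ f₁ Y X Z := by unfold ternaryForm; ring
      rw [hswap]
      refine ihA b₁.toNat (by omega) hb₁pos (by linarith [mul_comm a b₁]) ?_ _ _ _ rfl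
      rw [← hdet₁]; unfold ternaryDet; ring
  · have hswap (X Y Z : ℤ) : ternaryForm a b c' d' e' f X Y Z =
        ternaryForm a c' b d' f e' X Z Y := by unfold ternaryForm; ring
    rw [hswap]
    refine ihG _ (by omega) hg' ?_ _ _ _ rfl
    rw [← hdet']; unfold ternaryDet; ring

/-! ### Sums of three squares in the classes 1 and 2 modulo 4 -/

/-- With `p = (r ^ 2 + d) / (d * n - 1)`, the matrix `!![p, r, 1; r, d * n - 1, 0; 1, 0, n]` has
determinant one, and its form takes the value `n` at `(0, 0, 1)`. -/
theorem isSumThreeSq_of_dvd_sq_add {n d r : ℤ} (hd : 0 < d) (hq : 0 < d * n - 1)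
    (h : d * n - 1 ∣ r ^ 2 + d) : IsSumThreeSq n := by
  obtain ⟨p, hp⟩ := h
  have hp0 : 0 < p := by
    refine pos_of_mul_pos_right (a := d * n - 1) ?_ hq.le
    rw [← hp]; positivity
  have := isSumThreeSq_ternaryForm (a := p) (b := d * n - 1) (c := n) (d := 0) (e := 1) (f := r)
    hp0 (by linarith [mul_comm p (d * n - 1)]) (by unfold ternaryDet; linear_combination (-n) * hp)
    0 0 1
  simpa [ternaryForm] using this

theorem exists_sq_add_of_jacobiSym {d p : ℕ} (hp : p.Prime) (h : jacobiSym (-d) p = 1) :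
    ∃ r : ℤ, (p : ℤ) ∣ r ^ 2 + d := by
  have := Fact.mk hp
  obtain ⟨r, hr⟩ := ZMod.isSquare_of_jacobiSym_eq_one h
  obtain ⟨s, rfl⟩ := ZMod.intCast_surjective r
  refine ⟨s, (ZMod.intCast_zmod_eq_zero_iff_dvd _ p).1 ?_⟩
  push_cast at hr ⊢
  rw [sq, ← hr]; ring

/-- Dirichlet gives a prime `p = d * n - 1` with `d % 4 = 1`; then `p % 4 = 1`. Hence `(-d/p) =
(d/p) = (p/d) = (-1/d) = 1`, the third equality because `p ≡ -1` modulo `d`. -/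
theorem isSumThreeSq_of_two_mod_four {n : ℕ} (hn : n % 4 = 2) : IsSumThreeSq n := by
  have hcop : (n - 1).Coprime (4 * n) := by
    have h1 : (n - 1).Coprime n := (Nat.coprime_self_sub_left (by omega)).2 (by simp)
    have h2 : (n - 1).Coprime (2 ^ 2) :=
      Nat.Coprime.pow_right _ (Nat.coprime_two_right.2 (Nat.odd_iff.2 (by omega)))
    exact Nat.Coprime.mul_right h2 h1
  obtain ⟨p, hpn, hp, hmod⟩ :=
    Nat.forall_exists_prime_gt_and_modEq (n - 1) (q := 4 * n) (by omega) hcop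
  obtain ⟨j, hj⟩ := (Nat.modEq_iff_dvd' hpn.le).1 hmod.symm
  obtain ⟨d, hd⟩ : ∃ d, d = 4 * j + 1 := ⟨_, rfl⟩
  have hpd : p + 1 = d * n := by
    have : d * n = 4 * n * j + n := by rw [hd]; ring
    omega
  have hp4 : p % 4 = 1 := by
    have : (p + 1) % 4 = 2 := by rw [hpd, Nat.mul_mod, hn, hd]; omega
    omega
  have hd4 : d % 4 = 1 := by omega
  have hjac : jacobiSym (-d) p = 1 := by
    rw [jacobiSym.neg _ (Nat.odd_iff.2 (by omega)), ZMod.χ₄_nat_one_mod_four hp4, one_mul,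
      jacobiSym.quadratic_reciprocity_one_mod_four hd4 (Nat.odd_iff.2 (by omega)),
      jacobiSym.mod_left' (a₂ := -1) ?_,
      jacobiSym.at_neg_one (Nat.odd_iff.2 (by omega)), ZMod.χ₄_nat_one_mod_four hd4]
    refine Int.ModEq.symm ((Int.modEq_iff_dvd).2 ⟨n, ?_⟩)
    zify at hpd; linarith
  obtain ⟨r, hr⟩ := exists_sq_add_of_jacobiSym hp hjac
  have hq : (d : ℤ) * n - 1 = p := by zify at hpd; linarith
  exact isSumThreeSq_of_dvd_sq_add (d := d) (by omega) (by rw [hq]; exact_mod_cast hp.pos)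
    (by rwa [hq])

/-- For odd `d` the number `d * n - 1` is now even, so it is taken to be `2 * p` with `p` prime.
Choosing `p ≡ (3 * n - 1) / 2` modulo `4 * n` makes `d % 8 = 3`. Then `(-d/p) = (p/d)`, while `(2/d)
= -1` and `(2p/d) = (-1/d) = -1`, so `(p/d) = 1`. -/
theorem isSumThreeSq_of_one_mod_four {n : ℕ} (hn : n % 4 = 1) : IsSumThreeSq n := by
  obtain ⟨m, hm⟩ : ∃ m, 2 * m + 1 = 3 * n := ⟨(3 * n - 1) / 2, by omega⟩
  have hcop : m.Coprime (4 * n) := by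
    have h1 : m.Coprime n := by
      have : (m * 2).Coprime n := by
        rw [show m * 2 = 3 * n - 1 by omega, Nat.coprime_comm]
        refine (Nat.coprime_of_dvd' fun k _ h1 h2 => ?_)
        have h3 := Nat.dvd_sub (h1.mul_left 3) h2
        rwa [show 3 * n - (3 * n - 1) = 1 by omega] at h3
      exact this.coprime_mul_right
    have h2 : m.Coprime (2 ^ 2) :=
      Nat.Coprime.pow_right _ (Nat.coprime_two_right.2 (Nat.odd_iff.2 (by omega)))
    exact Nat.Coprime.mul_right h2 h1
  obtain ⟨p, hpn, hp, hmod⟩ :=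
    Nat.forall_exists_prime_gt_and_modEq m (q := 4 * n) (by omega) hcop
  obtain ⟨j, hj⟩ := (Nat.modEq_iff_dvd' hpn.le).1 hmod.symm
  obtain ⟨d, hd⟩ : ∃ d, d = 8 * j + 3 := ⟨_, rfl⟩
  have hpd : 2 * p + 1 = d * n := by
    have : d * n = 2 * (4 * n * j) + 3 * n := by rw [hd]; ring
    omega
  have hd4 : d % 4 = 3 := by omega
  have hp2 : p % 2 = 1 := by
    have h1 : 4 * n * j = 2 * (2 * n * j) := by ring
    omega
  have hdodd : Odd d := Nat.odd_iff.2 (by omega)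
  have hflip : jacobiSym (-d) p = jacobiSym p d := by
    rw [jacobiSym.neg _ (Nat.odd_iff.2 hp2)]
    rcases (show p % 4 = 1 ∨ p % 4 = 3 by omega) with hp4 | hp4
    · rw [ZMod.χ₄_nat_one_mod_four hp4, one_mul,
        jacobiSym.quadratic_reciprocity_one_mod_four hp4 hdodd]
    · rw [ZMod.χ₄_nat_three_mod_four hp4, jacobiSym.quadratic_reciprocity_three_mod_four hd4 hp4]
      ring
  have htwo : jacobiSym 2 d = -1 := by
    rw [jacobiSym.at_two hdodd, ZMod.χ₈_nat_mod_eight, show d % 8 = 3 by omega]; rfl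
  have hprod : jacobiSym (2 * p) d = -1 := by
    rw [jacobiSym.mod_left' (a₂ := -1) ?_, jacobiSym.at_neg_one hdodd,
      ZMod.χ₄_nat_three_mod_four hd4]
    refine Int.ModEq.symm ((Int.modEq_iff_dvd).2 ⟨n, ?_⟩)
    zify at hpd; linarith
  have hjac : jacobiSym (-d) p = 1 := by
    rw [jacobiSym.mul_left, htwo] at hprod
    rw [hflip]; linarith
  obtain ⟨r, hr⟩ := exists_sq_add_of_jacobiSym hp hjac
  have hq : (d : ℤ) * n - 1 = 2 * p := by zify at hpd; linarith
  have hpcop : IsCoprime (2 : ℤ) p := by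
    rw [Int.isCoprime_iff_gcd_eq_one]
    exact_mod_cast Nat.coprime_two_left.2 (Nat.odd_iff.2 hp2)
  -- The modulus is `2 * p`, so the root must also be odd; adding the odd prime `p` changes its
  -- parity.
  obtain ⟨s, hs, hs2⟩ : ∃ s : ℤ, (p : ℤ) ∣ s ^ 2 + d ∧ (2 : ℤ) ∣ s ^ 2 + d := by
    have hdd : (d : ℤ) % 2 = 1 := by omega
    have hpp : (p : ℤ) % 2 = 1 := by omega
    rcases Int.emod_two_eq_zero_or_one r with h | h
    · refine ⟨r + p, ?_, ?_⟩
      · rw [show (r + p) ^ 2 + (d : ℤ) = (r ^ 2 + d) + p * (2 * r + p) by ring]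
        exact hr.add (dvd_mul_right _ _)
      · refine Int.dvd_of_emod_eq_zero ?_
        have : (r + p) % 2 = 1 := by omega
        simp [Int.add_emod, pow_two, Int.mul_emod, hdd, h, hpp]
    · refine ⟨r, hr, Int.dvd_of_emod_eq_zero ?_⟩
      simp [Int.add_emod, pow_two, Int.mul_emod, hdd, h]
  exact isSumThreeSq_of_dvd_sq_add (d := d) (by omega) (by rw [hq]; have := hp.pos; omega)
    (by rw [hq]; exact hpcop.mul_dvd hs2 hs)

theorem isSumThreeSq_of_emod_four {n : ℤ} (h0 : 0 ≤ n) (h : n % 4 = 1 ∨ n % 4 = 2) :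
    IsSumThreeSq n := by
  lift n to ℕ using h0
  rcases h with h | h
  · exact isSumThreeSq_of_one_mod_four (by omega)
  · exact isSumThreeSq_of_two_mod_four (by omega)

theorem IsSumThreeSq.four_mul {n : ℤ} (h : IsSumThreeSq n) : IsSumThreeSq (4 * n) := by
  obtain ⟨u, v, w, rfl⟩ := h
  exact ⟨2 * u, 2 * v, 2 * w, by ring⟩

/-! ### The numbers to be split into three squares, and nonnegativity of the solutions -/

/-- The number is 1 modulo 4 for odd `k`, and four times such a number for `k` twice an odd number.
-/
theorem isSumThreeSq_mul_sq_sub_mul_sq {A B k T : ℤ} (hA : A % 4 = 1) (hk : ¬ 4 ∣ k)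
    (h0 : 0 ≤ A * k ^ 2 - B * (4 * T ^ 2) ^ 2) : IsSumThreeSq (A * k ^ 2 - B * (4 * T ^ 2) ^ 2) := by
  obtain ⟨A', rfl⟩ : ∃ A', A = 4 * A' + 1 := ⟨A / 4, by omega⟩
  rcases Int.even_or_odd' k with ⟨m, rfl | rfl⟩
  · obtain ⟨r, rfl⟩ : ∃ r, m = 2 * r + 1 := ⟨m / 2, by omega⟩
    have e : (4 * A' + 1) * (2 * (2 * r + 1)) ^ 2 - B * (4 * T ^ 2) ^ 2 =
      4 * (4 * (A' * (2 * r + 1) ^ 2 + r ^ 2 + r - B * T ^ 4) + 1) := by ring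
    rw [e] at h0 ⊢
    exact (isSumThreeSq_of_emod_four (by omega) (by omega)).four_mul
  · have e : (4 * A' + 1) * (2 * m + 1) ^ 2 - B * (4 * T ^ 2) ^ 2 =
      4 * (A' * (2 * m + 1) ^ 2 + m ^ 2 + m - B * 4 * T ^ 4) + 1 := by ring
    rw [e] at h0 ⊢
    exact isSumThreeSq_of_emod_four (by omega) (by omega)

/-- The parity condition `hs` is necessary: for `k` even and `s` odd the number is 7 modulo 8. -/
theorem isSumThreeSq_fourteen_mul_sq_sub {k s : ℤ} (hk : ¬ 4 ∣ k) (hs : 2 ∣ k → 2 ∣ s)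
    (h0 : 0 ≤ 14 * k ^ 2 - s ^ 4) : IsSumThreeSq (14 * k ^ 2 - s ^ 4) := by
  rcases Int.even_or_odd' k with ⟨m, rfl | rfl⟩
  · obtain ⟨r, rfl⟩ : ∃ r, m = 2 * r + 1 := ⟨m / 2, by omega⟩
    obtain ⟨t, rfl⟩ := hs (by omega)
    have e : 14 * (2 * (2 * r + 1)) ^ 2 - (2 * t) ^ 4 =
      4 * (4 * (14 * (r ^ 2 + r) + 3 - t ^ 4) + 2) := by ring
    rw [e] at h0 ⊢
    exact (isSumThreeSq_of_emod_four (by omega) (by omega)).four_mul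
  · rcases Int.even_or_odd' s with ⟨t, rfl | rfl⟩
    · have e : 14 * (2 * m + 1) ^ 2 - (2 * t) ^ 4 =
        4 * (14 * (m ^ 2 + m) + 3 - 4 * t ^ 4) + 2 := by ring
      rw [e] at h0 ⊢
      exact isSumThreeSq_of_emod_four (by omega) (by omega)
    · have e : 14 * (2 * m + 1) ^ 2 - (2 * t + 1) ^ 4 =
        4 * (14 * (m ^ 2 + m) + 3 - 4 * t ^ 4 - 8 * t ^ 3 - 6 * t ^ 2 - 2 * t) + 1 := by ring
      rw [e] at h0 ⊢
      exact isSumThreeSq_of_emod_four (by omega) (by omega)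

/-- Four integers whose squares sum to `k ^ 2` and which satisfy `x + 2 * y + lam * z = S` with `S`
large have nonnegative `x`, `y`, `z`. -/
theorem exists_nat_rep_of_int_rep {lam k S : ℕ} {x y z w : ℤ} (hlam : 2 ≤ lam)
    (hsum : (k : ℤ) ^ 2 = x ^ 2 + y ^ 2 + z ^ 2 + w ^ 2) (hlin : x + 2 * y + lam * z = S)
    (hS : (4 + lam ^ 2) * k ^ 2 ≤ S ^ 2) :
    ∃ x y z w : ℕ, k ^ 2 = x ^ 2 + y ^ 2 + z ^ 2 + w ^ 2 ∧ x + 2 * y + lam * z = S := by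
  have hS0 : (0 : ℤ) ≤ S := by positivity
  have hl : (2 : ℤ) ≤ lam := by exact_mod_cast hlam
  have hS' : (4 + (lam : ℤ) ^ 2) * k ^ 2 ≤ S ^ 2 := by exact_mod_cast hS
  -- If one variable were negative, the other two terms of the linear form would exceed `S`. By
  -- Cauchy–Schwarz the square of their sum is at most `(4 + lam ^ 2) * k ^ 2 ≤ S ^ 2`.
  have key (p q y z t M : ℤ) (ht : 0 < t) (he : p * y + q * z = S + t)
      (hle : y ^ 2 + z ^ 2 ≤ (k : ℤ) ^ 2) (hM : p ^ 2 + q ^ 2 ≤ 4 + (lam : ℤ) ^ 2) : False := by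
    have h1 : (p * y + q * z) ^ 2 ≤ (p ^ 2 + q ^ 2) * (y ^ 2 + z ^ 2) := by
      nlinarith [sq_nonneg (p * z - q * y)]
    have h2 : (p ^ 2 + q ^ 2) * (y ^ 2 + z ^ 2) ≤ (4 + (lam : ℤ) ^ 2) * k ^ 2 :=
      mul_le_mul hM hle (by positivity) (by positivity)
    rw [he] at h1
    nlinarith
  have hx : 0 ≤ x := by
    by_contra! h
    exact key 2 lam y z (-x) 0 (by omega) (by linarith)
      (by nlinarith [sq_nonneg x, sq_nonneg w]) (by norm_num)
  have hy : 0 ≤ y := by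
    by_contra! h
    exact key 1 lam x z (-(2 * y)) 0 (by omega) (by linarith)
      (by nlinarith [sq_nonneg y, sq_nonneg w]) (by norm_num)
  have hz : 0 ≤ z := by
    by_contra! h
    exact key 1 2 x y (-(lam * z)) 0 (by nlinarith) (by linarith)
      (by nlinarith [sq_nonneg z, sq_nonneg w]) (by nlinarith)
  lift x to ℕ using hx
  lift y to ℕ using hy
  lift z to ℕ using hz
  refine ⟨x, y, z, w.natAbs, ?_, by exact_mod_cast hlin⟩
  zify
  rw [sq_abs, hsum]

/-! ### Integer representations for `lam = 2` -/

theorem exists_sq_eq_three_dvd_add {u S : ℤ} (hu : ¬ 3 ∣ u) (hS : ¬ 3 ∣ S) :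
    ∃ p : ℤ, (3 * p - S) ^ 2 = u ^ 2 := by
  have hu' : u % 3 = 1 ∨ u % 3 = 2 := by omega
  have hS' : S % 3 = 1 ∨ S % 3 = 2 := by omega
  clear hu hS
  rcases (show 3 ∣ u + S ∨ 3 ∣ S - u by omega) with ⟨p, hp⟩ | ⟨p, hp⟩
  · exact ⟨p, by rw [← hp]; ring⟩
  · exact ⟨p, by rw [← hp]; ring⟩

theorem sq_emod_three_eq (u : ℤ) :
    (u % 3 = 0 ∧ u ^ 2 % 3 = 0) ∨ ((u % 3 = 1 ∨ u % 3 = 2) ∧ u ^ 2 % 3 = 1) := by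
  rcases (show u % 3 = 0 ∨ u % 3 = 1 ∨ u % 3 = 2 by omega) with h | h | h
  · exact Or.inl ⟨by simp [h], by simp [pow_two, Int.mul_emod, h]⟩
  · exact Or.inr ⟨by simp [h], by simp [pow_two, Int.mul_emod, h]⟩
  · exact Or.inr ⟨by simp [h], by simp [pow_two, Int.mul_emod, h]⟩

/-- The vectors `(1, 2, 2)`, `(2, 1, -2)`, `(2, -2, 1)` are orthogonal of norm 9, and `S, u, v` are
to be the inner products of `(x, y, z)` with them. Since `u ^ 2 + v ^ 2 + c ^ 2 ≡ 2` modulo 3,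
exactly one of the three roots is divisible by 3; it gives `3 * w`. The signs of the others are
chosen so that `u ≡ v ≡ -S` modulo 3. -/
theorem exists_int_rep_two_of_not_dvd {k S : ℤ} (hS : ¬ 3 ∣ S)
    (h : IsSumThreeSq (9 * k ^ 2 - S ^ 2)) :
    ∃ x y z w : ℤ, k ^ 2 = x ^ 2 + y ^ 2 + z ^ 2 + w ^ 2 ∧ x + 2 * y + 2 * z = S := by
  obtain ⟨u, v, c, huvc, hc, hu, hv⟩ : ∃ u v c : ℤ, 9 * k ^ 2 - S ^ 2 = u ^ 2 + v ^ 2 + c ^ 2 ∧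
      3 ∣ c ∧ ¬ 3 ∣ u ∧ ¬ 3 ∣ v := by
    obtain ⟨u, v, c, huvc⟩ := h
    have h1 := sq_emod_three_eq u
    have h2 := sq_emod_three_eq v
    have h3 := sq_emod_three_eq c
    have h4 := sq_emod_three_eq S
    rcases (show 3 ∣ c ∧ ¬ 3 ∣ u ∧ ¬ 3 ∣ v ∨ 3 ∣ u ∧ ¬ 3 ∣ c ∧ ¬ 3 ∣ v ∨
      3 ∣ v ∧ ¬ 3 ∣ u ∧ ¬ 3 ∣ c by omega) with h | h | h
    · exact ⟨u, v, c, huvc, h⟩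
    · exact ⟨c, v, u, by rw [huvc]; ring, h⟩
    · exact ⟨u, c, v, by rw [huvc]; ring, h⟩
  obtain ⟨w, rfl⟩ := hc
  obtain ⟨p, hp⟩ := exists_sq_eq_three_dvd_add hu hS
  obtain ⟨q, hq⟩ := exists_sq_eq_three_dvd_add hv hS
  rw [← hp, ← hq] at huvc
  have hdvd : 3 ∣ S * (S - 2 * (p + q)) :=
    ⟨k ^ 2 - p ^ 2 - q ^ 2 - w ^ 2, by linarith⟩
  obtain ⟨r, hr⟩ := (Int.prime_three.dvd_or_dvd hdvd).resolve_left hS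
  obtain rfl : S = 2 * (p + q) + 3 * r := by linarith
  exact ⟨-r, p + r, q + r, w, by linarith, by ring⟩

/-- In the same orthogonal frame, `(x, y, z) = T * (1, 2, 2) + (u * (2, 1, -2) + v * (2, -2, 1)) /
3`, which is integral as soon as `3 ∣ u + v`. -/
theorem exists_int_rep_two_of_dvd {k T : ℤ} (h : IsSumThreeSq (k ^ 2 - 9 * T ^ 2)) :
    ∃ x y z w : ℤ, k ^ 2 = x ^ 2 + y ^ 2 + z ^ 2 + w ^ 2 ∧ x + 2 * y + 2 * z = 9 * T := by
  obtain ⟨u, v, w, huvw, g, hg⟩ : ∃ u v w : ℤ, k ^ 2 - 9 * T ^ 2 = u ^ 2 + v ^ 2 + w ^ 2 ∧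
      3 ∣ u + v := by
    obtain ⟨u, v, w, huvw⟩ := h
    have h1 := sq_emod_three_eq u
    have h2 := sq_emod_three_eq v
    have h3 := sq_emod_three_eq w
    have h4 := sq_emod_three_eq k
    -- Exactly two of `u, v, w` being prime to 3 is impossible, since `k ^ 2` is not 2 modulo 3. So
    -- at least two are divisible by 3, or none is and two of them agree up to sign.
    rcases (show 3 ∣ u + v ∨ 3 ∣ u + w ∨ 3 ∣ v + w ∨ 3 ∣ u - v by omega) with h | h | h | h
    · exact ⟨u, v, w, huvw, h⟩
    · exact ⟨u, w, v, by rw [huvw]; ring, h⟩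
    · exact ⟨v, w, u, by rw [huvw]; ring, h⟩
    · exact ⟨u, -v, w, by rw [huvw]; ring, h⟩
  obtain rfl : u = 3 * g - v := by linarith
  exact ⟨T + 2 * g, 2 * T + g - v, 2 * T + v - 2 * g, w, by linarith, by ring⟩

theorem exists_nat_rep_two {k t : ℕ} (hk : ¬ 4 ∣ k) (h1 : 8 * k ^ 2 ≤ (2 * t) ^ 4)
    (h2 : (2 * t) ^ 4 ≤ 9 * k ^ 2) :
    ∃ x y z w : ℕ, k ^ 2 = x ^ 2 + y ^ 2 + z ^ 2 + w ^ 2 ∧ x + 2 * y + 2 * z = (2 * t) ^ 2 := by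
  have hk' : ¬ (4 : ℤ) ∣ k := by omega
  zify at h2
  have hrep : ∃ x y z w : ℤ, (k : ℤ) ^ 2 = x ^ 2 + y ^ 2 + z ^ 2 + w ^ 2 ∧
      x + 2 * y + 2 * z = 4 * (t : ℤ) ^ 2 := by
    by_cases h3 : (3 : ℤ) ∣ t
    · obtain ⟨r, hr⟩ := h3
      rw [hr] at h2
      have := isSumThreeSq_mul_sq_sub_mul_sq (A := 1) (B := 9) (k := k) (T := r) rfl hk'
        (by linarith)
      rw [one_mul] at this
      obtain ⟨x, y, z, w, h, h'⟩ := exists_int_rep_two_of_dvd this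
      exact ⟨x, y, z, w, h, by rw [h', hr]; ring⟩
    · have := isSumThreeSq_mul_sq_sub_mul_sq (A := 9) (B := 1) (k := k) (T := t) rfl hk'
        (by linarith)
      rw [one_mul] at this
      refine exists_int_rep_two_of_not_dvd (fun h => h3 ?_) this
      exact Int.prime_three.dvd_of_dvd_pow (Or.resolve_left (Int.prime_three.dvd_or_dvd h)
        (by norm_num))
  obtain ⟨x, y, z, w, h, h'⟩ := hrep
  exact exists_nat_rep_of_int_rep le_rfl h (by push_cast; linarith) (by linarith)

/-! ### Integer representations for `lam = 3`, through quaternions -/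

/-- The quaternion `S + a i + b j + c k` is, modulo `n`, annihilated on the right by
`i + 2 j + 3 k`. -/
def AnnihilatesModulo (n S a b c : ℤ) : Prop :=
  n ∣ a + 2 * b + 3 * c ∧ n ∣ S + 3 * b - 2 * c ∧ n ∣ 2 * S + c - 3 * a ∧ n ∣ 3 * S + 2 * a - b

/-- The eight signed permutations represent the 24 rotations of the cube modulo the rotation of
order three in `AnnihilatesModulo.rotate`, which preserves the condition. -/
theorem zmod_seven_exists_annihilates : ∀ S a b c : ZMod 7, S ^ 2 + (a ^ 2 + b ^ 2 + c ^ 2) = 0 →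
    ∃ v ∈ [(a, b, c), (a, -b, -c), (-a, b, -c), (-a, -b, c), (c, -b, a), (c, b, -a),
      (-c, -b, -a), (-c, b, a)], v.1 + 2 * v.2.1 + 3 * v.2.2 = 0 ∧ S + 3 * v.2.1 - 2 * v.2.2 = 0 ∧
      2 * S + v.2.2 - 3 * v.1 = 0 ∧ 3 * S + 2 * v.1 - v.2.1 = 0 := by
  decide +kernel

theorem exists_annihilatesModulo_seven {S a b c : ℤ} (h : 7 ∣ S ^ 2 + (a ^ 2 + b ^ 2 + c ^ 2)) :
    ∃ a' b' c' : ℤ, a' ^ 2 + b' ^ 2 + c' ^ 2 = a ^ 2 + b ^ 2 + c ^ 2 ∧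
      AnnihilatesModulo 7 S a' b' c' := by
  have h7 : ((S : ZMod 7)) ^ 2 + ((a : ZMod 7) ^ 2 + (b : ZMod 7) ^ 2 + (c : ZMod 7) ^ 2) = 0 := by
    have := (ZMod.intCast_zmod_eq_zero_iff_dvd _ 7).2 h
    push_cast at this
    exact this
  have key (x y z : ℤ) (h : (x : ZMod 7) + 2 * y + 3 * z = 0 ∧ (S : ZMod 7) + 3 * y - 2 * z = 0 ∧
      2 * (S : ZMod 7) + z - 3 * x = 0 ∧ 3 * (S : ZMod 7) + 2 * x - y = 0) :
      AnnihilatesModulo 7 S x y z := by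
    refine ⟨(ZMod.intCast_zmod_eq_zero_iff_dvd _ 7).1 ?_,
      (ZMod.intCast_zmod_eq_zero_iff_dvd _ 7).1 ?_, (ZMod.intCast_zmod_eq_zero_iff_dvd _ 7).1 ?_,
      (ZMod.intCast_zmod_eq_zero_iff_dvd _ 7).1 ?_⟩ <;> push_cast
    exacts [h.1, h.2.1, h.2.2.1, h.2.2.2]
  obtain ⟨v, hv, hv'⟩ := zmod_seven_exists_annihilates S a b c h7
  simp only [List.mem_cons, List.not_mem_nil, or_false] at hv
  rcases hv with rfl | rfl | rfl | rfl | rfl | rfl | rfl | rfl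
  · exact ⟨a, b, c, by ring, key _ _ _ hv'⟩
  · exact ⟨a, -b, -c, by ring, key _ _ _ (by push_cast; exact hv')⟩
  · exact ⟨-a, b, -c, by ring, key _ _ _ (by push_cast; exact hv')⟩
  · exact ⟨-a, -b, c, by ring, key _ _ _ (by push_cast; exact hv')⟩
  · exact ⟨c, -b, a, by ring, key _ _ _ (by push_cast; exact hv')⟩
  · exact ⟨c, b, -a, by ring, key _ _ _ (by push_cast; exact hv')⟩
  · exact ⟨-c, -b, -a, by ring, key _ _ _ (by push_cast; exact hv')⟩
  · exact ⟨-c, b, a, by ring, key _ _ _ (by push_cast; exact hv')⟩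

theorem AnnihilatesModulo.rotate {S a b c : ℤ} (h : AnnihilatesModulo 7 S a b c) :
    AnnihilatesModulo 7 S b (-c) (-a) := by
  unfold AnnihilatesModulo at *
  omega

/-- Modulo 2 the condition says `S ≡ b` and `a ≡ c`. As the norm is even, `S, p, q, r` can be split
into two pairs of equal parity, and the rotation of order three, harmless modulo 7, carries any such
splitting to the required one. -/
theorem exists_annihilatesModulo_fourteen {S a b c : ℤ}
    (h : 14 ∣ S ^ 2 + (a ^ 2 + b ^ 2 + c ^ 2)) :
    ∃ a' b' c' : ℤ, a' ^ 2 + b' ^ 2 + c' ^ 2 = a ^ 2 + b ^ 2 + c ^ 2 ∧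
      AnnihilatesModulo 14 S a' b' c' := by
  obtain ⟨p, q, r, hsum, hann⟩ := exists_annihilatesModulo_seven (dvd_trans (by norm_num) h)
  rw [← hsum] at h ⊢
  have hpar : (S + p + q + r) % 2 = 0 := by
    have h2 : Even (S ^ 2 + (p ^ 2 + q ^ 2 + r ^ 2)) :=
      even_iff_two_dvd.2 (dvd_trans (by norm_num) h)
    rw [← Int.even_iff]
    simp only [Int.even_add, Int.even_pow' two_ne_zero] at h2 ⊢
    tauto
  have key {x y z : ℤ} (hx : AnnihilatesModulo 7 S x y z) (h1 : 2 ∣ S - y) (h2 : 2 ∣ x - z) :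
      AnnihilatesModulo 14 S x y z := by
    have h14 (n : ℤ) (hn : 7 ∣ n) (hn' : 2 ∣ n) : 14 ∣ n := by omega
    exact ⟨h14 _ hx.1 (by omega), h14 _ hx.2.1 (by omega), h14 _ hx.2.2.1 (by omega),
      h14 _ hx.2.2.2 (by omega)⟩
  rcases (show 2 ∣ S - q ∧ 2 ∣ p - r ∨ 2 ∣ S - r ∧ 2 ∣ p - q ∨ 2 ∣ S - p ∧ 2 ∣ q - r by omega)
    with h | h | h
  · exact ⟨p, q, r, rfl, key hann h.1 h.2⟩
  · exact ⟨q, -r, -p, by ring, key hann.rotate (by omega) (by omega)⟩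
  · exact ⟨-r, - -p, -q, by ring, key hann.rotate.rotate (by omega) (by omega)⟩

/-- The product of `S + p i + q j + r k` and `i + 2 j + 3 k` has norm `14 * k ^ 2 * 14` and is
divisible by 14. Its quotient by 14 therefore has norm `k ^ 2`; the components of the quotient are
`-w, x, y, z`. -/
theorem exists_int_rep_three {k S : ℤ} (h : IsSumThreeSq (14 * k ^ 2 - S ^ 2)) :
    ∃ x y z w : ℤ, k ^ 2 = x ^ 2 + y ^ 2 + z ^ 2 + w ^ 2 ∧ x + 2 * y + 3 * z = S := by
  obtain ⟨a, b, c, habc⟩ := h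
  obtain ⟨p, q, r, hsum, ⟨w, hw⟩, ⟨x, hx⟩, ⟨y, hy⟩, ⟨z, hz⟩⟩ :=
    exists_annihilatesModulo_fourteen (S := S) (a := a) (b := b) (c := c)
      ⟨k ^ 2, by linarith⟩
  refine ⟨x, y, z, w, ?_, by linarith⟩
  have h1 : (14 * w) ^ 2 + (14 * x) ^ 2 + (14 * y) ^ 2 + (14 * z) ^ 2 =
      14 * (S ^ 2 + (p ^ 2 + q ^ 2 + r ^ 2)) := by
    rw [← hw, ← hx, ← hy, ← hz]; ring
  linarith

theorem exists_nat_rep_three {k s : ℕ} (hk : ¬ 4 ∣ k) (hs : 2 ∣ k → 2 ∣ s)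
    (h1 : 13 * k ^ 2 ≤ s ^ 4) (h2 : s ^ 4 ≤ 14 * k ^ 2) :
    ∃ x y z w : ℕ, k ^ 2 = x ^ 2 + y ^ 2 + z ^ 2 + w ^ 2 ∧ x + 2 * y + 3 * z = s ^ 2 := by
  zify at h2
  have h3 := isSumThreeSq_fourteen_mul_sq_sub (k := k) (s := s) (by omega) (by omega)
    (by linarith)
  rw [show (s : ℤ) ^ 4 = (s ^ 2) ^ 2 by ring] at h3
  obtain ⟨x, y, z, w, h, h'⟩ := exists_int_rep_three h3
  exact exists_nat_rep_of_int_rep (by norm_num) h (by push_cast; linarith) (by linarith)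

theorem exists_two_mul_pow_four_between {M N c k : ℕ} (hN : 0 < N) (hc : 0 < c)
    (hMN : ∀ t, c ≤ t → M * (t + 1) ^ 4 ≤ N * t ^ 4) (hk : (2 * c) ^ 4 ≤ N * k ^ 2) :
    ∃ t : ℕ, M * k ^ 2 ≤ (2 * t) ^ 4 ∧ (2 * t) ^ 4 ≤ N * k ^ 2 := by
  have hex : ∃ t : ℕ, N * k ^ 2 < (2 * (t + 1)) ^ 4 :=
    ⟨N * k ^ 2, by nlinarith [Nat.le_self_pow (show 4 ≠ 0 by norm_num) (2 * (N * k ^ 2 + 1))]⟩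
  obtain ⟨t, ht, hmin⟩ : ∃ t : ℕ, N * k ^ 2 < (2 * (t + 1)) ^ 4 ∧
      ∀ r < t, (2 * (r + 1)) ^ 4 ≤ N * k ^ 2 :=
    ⟨Nat.find hex, Nat.find_spec hex, fun r hr => not_lt.1 (Nat.find_min hex hr)⟩
  have hct : c ≤ t := by
    by_contra! h
    have : (2 * (t + 1)) ^ 4 ≤ (2 * c) ^ 4 := Nat.pow_le_pow_left (by omega) 4
    omega
  have hle : (2 * t) ^ 4 ≤ N * k ^ 2 := by
    have := hmin (t - 1) (by omega)
    rwa [show t - 1 + 1 = t by omega] at this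
  refine ⟨t, le_of_mul_le_mul_left (a := N) ?_ hN, hle⟩
  calc N * (M * k ^ 2) = M * (N * k ^ 2) := by ring
    _ ≤ M * (2 * (t + 1)) ^ 4 := Nat.mul_le_mul_left _ ht.le
    _ = 16 * (M * (t + 1) ^ 4) := by ring
    _ ≤ 16 * (N * t ^ 4) := Nat.mul_le_mul_left _ (hMN t hct)
    _ = N * (2 * t) ^ 4 := by ring

/-- `(k, s, y, z, d)` encodes a representation of `k ^ 2` with `w = k - d` and linear form `s ^ 2`. -/
def isWitness (lam k : ℕ) : ℕ × ℕ × ℕ × ℕ × ℕ → Bool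
  | (k', s, y, z, d) => Nat.beq k' k && (Nat.ble 1 s && (Nat.ble (2 * y + lam * z) (s * s) &&
      Nat.beq (k * k) ((s * s - (2 * y + lam * z)) * (s * s - (2 * y + lam * z)) + y * y + z * z +
        (k - d) * (k - d))))

theorem exists_rep_of_isWitness {lam k : ℕ} {e : ℕ × ℕ × ℕ × ℕ × ℕ} (h : isWitness lam k e) :
    ∃ s x y z w : ℕ, 0 < s ∧ k ^ 2 = x ^ 2 + y ^ 2 + z ^ 2 + w ^ 2 ∧
      x + 2 * y + lam * z = s ^ 2 := by
  obtain ⟨k', s, y, z, d⟩ := e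
  simp only [isWitness, Bool.and_eq_true, Nat.ble_eq, Nat.beq_eq] at h
  obtain ⟨-, h0, h1, h2⟩ := h
  exact ⟨s, _, y, z, _, h0, by simpa only [pow_two] using h2, by rw [pow_two]; omega⟩

/-- `k` has a square factor, or some `s < bound` of admissible parity satisfies
`M * k ^ 2 ≤ s ^ 4 ≤ (M + 1) * k ^ 2`, or `k` is in the table. -/
def smallCheck (lam M bound : ℕ) (table : List (ℕ × ℕ × ℕ × ℕ × ℕ)) (parity : ℕ → ℕ → Bool)
    (k : ℕ) : Bool :=
  (Nat.beq (k % 4) 0 || Nat.beq (k % 9) 0 || Nat.beq (k % 25) 0 || Nat.beq (k % 49) 0) ||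
    ((List.range bound).any (fun s => Nat.ble (M * (k * k)) (s * s * (s * s)) &&
      (Nat.ble (s * s * (s * s)) ((M + 1) * (k * k)) && parity k s)) ||
      table.any (isWitness lam k))

theorem smallCheck_spec {lam M bound k : ℕ} {table : List (ℕ × ℕ × ℕ × ℕ × ℕ)}
    {parity : ℕ → ℕ → Bool} (h : smallCheck lam M bound table parity k) :
    (k % 4 = 0 ∨ k % 9 = 0 ∨ k % 25 = 0 ∨ k % 49 = 0) ∨
    (∃ s, parity k s ∧ M * k ^ 2 ≤ s ^ 4 ∧ s ^ 4 ≤ (M + 1) * k ^ 2) ∨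
    ∃ e, isWitness lam k e := by
  simp only [smallCheck, Bool.or_eq_true, List.any_eq_true, Bool.and_eq_true, Nat.ble_eq,
    Nat.beq_eq] at h
  rcases h with h | ⟨s, -, h1, h2, h3⟩ | ⟨e, -, he⟩
  · exact Or.inl (by tauto)
  · refine Or.inr (Or.inl ⟨s, h3, ?_, ?_⟩)
    · calc M * k ^ 2 = M * (k * k) := by ring
        _ ≤ s * s * (s * s) := h1
        _ = s ^ 4 := by ring
    · calc s ^ 4 = s * s * (s * s) := by ring
        _ ≤ (M + 1) * (k * k) := h2
        _ = (M + 1) * k ^ 2 := by ring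
  · exact Or.inr (Or.inr ⟨e, he⟩)

def witnessesTwo : List (ℕ × ℕ × ℕ × ℕ × ℕ) :=
  [(1, 1, 0, 0, 1), (2, 2, 2, 0, 2), (3, 2, 1, 0, 1), (5, 3, 2, 2, 1), (6, 3, 3, 1, 1),
   (7, 4, 5, 2, 3), (10, 4, 4, 2, 2), (11, 4, 6, 2, 2), (13, 4, 2, 1, 5), (14, 3, 1, 1, 1),
   (15, 3, 2, 0, 1), (17, 4, 5, 2, 1), (19, 4, 2, 2, 2), (21, 4, 6, 1, 1), (23, 5, 6, 0, 5),
   (26, 7, 19, 5, 9), (29, 6, 14, 2, 4), (30, 6, 8, 4, 4), (31, 4, 5, 0, 1), (33, 5, 4, 2, 3),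
   (37, 5, 6, 6, 1), (38, 5, 5, 5, 1), (39, 5, 6, 4, 1), (41, 3, 0, 0, 1), (42, 5, 7, 3, 1),
   (43, 6, 9, 0, 5), (46, 5, 9, 3, 1), (47, 5, 8, 2, 1), (51, 6, 10, 1, 3), (53, 4, 2, 1, 1),
   (55, 4, 3, 0, 1), (57, 5, 4, 4, 1), (58, 5, 5, 3, 1), (59, 8, 14, 14, 4), (61, 5, 6, 2, 1),
   (62, 5, 11, 1, 1), (65, 4, 0, 0, 2), (70, 8, 12, 12, 4), (71, 7, 20, 4, 3), (73, 5, 8, 0, 1),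
   (74, 7, 11, 5, 3), (77, 6, 9, 6, 1), (78, 6, 6, 4, 2), (79, 8, 14, 13, 3), (82, 6, 18, 0, 2),
   (83, 7, 14, 2, 3), (85, 10, 24, 23, 7), (91, 8, 26, 6, 4), (93, 6, 7, 6, 1), (94, 5, 3, 3, 1),
   (95, 5, 4, 2, 1), (97, 8, 12, 3, 7), (101, 8, 23, 8, 3), (102, 6, 4, 0, 4), (103, 5, 6, 0, 1),
   (105, 6, 13, 2, 1), (106, 8, 24, 0, 4), (107, 8, 9, 8, 5), (115, 8, 14, 14, 2),
   (118, 8, 16, 14, 2), (119, 7, 8, 4, 3), (121, 8, 13, 8, 3), (122, 8, 14, 12, 2),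
   (123, 6, 12, 1, 1), (127, 10, 20, 19, 5), (129, 6, 6, 5, 1), (130, 8, 20, 10, 2),
   (131, 6, 15, 0, 1), (133, 8, 20, 8, 2), (142, 7, 11, 9, 1), (143, 7, 14, 8, 1),
   (145, 7, 12, 8, 1), (146, 7, 13, 11, 1), (149, 6, 10, 1, 1), (151, 8, 14, 5, 3),
   (154, 7, 15, 9, 1), (155, 8, 18, 6, 2), (157, 7, 14, 6, 1), (158, 8, 24, 6, 2),
   (159, 6, 11, 0, 1), (161, 7, 16, 8, 1), (173, 10, 34, 14, 4), (174, 8, 16, 6, 2),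
   (177, 7, 16, 4, 1), (178, 8, 26, 4, 2), (179, 8, 26, 6, 2), (181, 7, 18, 6, 1),
   (182, 7, 13, 5, 1), (183, 6, 5, 4, 1), (185, 6, 6, 3, 1), (186, 8, 18, 4, 2),
   (187, 8, 22, 2, 2), (190, 7, 17, 3, 1), (191, 7, 14, 4, 1), (205, 7, 18, 2, 1),
   (206, 8, 26, 0, 2), (209, 7, 20, 4, 1), (210, 7, 9, 7, 1), (211, 10, 31, 14, 3),
   (213, 7, 10, 6, 1), (214, 11, 37, 11, 5), (215, 7, 16, 2, 1), (217, 8, 11, 4, 3),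
   (218, 7, 11, 5, 1), (219, 9, 26, 2, 3), (221, 10, 32, 17, 3), (222, 5, 1, 1, 1),
   (223, 5, 2, 0, 1), (241, 7, 20, 0, 1), (242, 8, 12, 6, 2), (246, 9, 25, 1, 3),
   (247, 7, 18, 0, 1), (249, 8, 19, 10, 1), (251, 10, 15, 12, 5), (253, 8, 18, 9, 1),
   (254, 10, 20, 0, 8), (255, 7, 22, 0, 1), (257, 6, 5, 2, 1), (258, 7, 15, 1, 1),
   (259, 8, 20, 9, 1), (278, 8, 18, 0, 2), (281, 10, 24, 20, 2), (282, 10, 24, 22, 2),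
   (283, 7, 2, 2, 3), (285, 8, 18, 7, 1), (286, 7, 11, 3, 1), (287, 10, 26, 18, 2),
   (289, 7, 24, 0, 1), (290, 10, 24, 18, 2), (291, 8, 10, 6, 2), (293, 10, 24, 24, 2),
   (295, 7, 12, 2, 1), (298, 10, 26, 16, 2), (299, 8, 23, 8, 1), (319, 7, 14, 0, 1),
   (321, 8, 16, 0, 2), (322, 10, 32, 14, 2), (323, 8, 23, 4, 1), (326, 10, 30, 12, 2),
   (327, 8, 21, 4, 1), (329, 10, 32, 12, 2), (330, 10, 22, 16, 2), (331, 11, 34, 14, 3),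
   (334, 11, 41, 17, 3), (335, 11, 40, 20, 3), (337, 8, 18, 5, 1), (338, 10, 24, 14, 2),
   (339, 8, 25, 4, 1), (341, 10, 44, 1, 3), (363, 8, 7, 2, 3), (365, 7, 10, 2, 1),
   (366, 9, 19, 17, 1), (367, 8, 20, 3, 1), (370, 10, 34, 8, 2), (371, 10, 47, 2, 3),
   (373, 8, 15, 6, 1), (374, 7, 11, 1, 1), (377, 10, 36, 8, 2), (379, 10, 20, 1, 5),
   (381, 9, 22, 14, 1), (382, 11, 25, 17, 3), (383, 8, 16, 5, 1), (385, 7, 12, 0, 1),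
   (409, 8, 18, 3, 1), (410, 9, 23, 11, 1), (411, 8, 25, 0, 1), (413, 14, 62, 26, 6),
   (415, 8, 27, 0, 1), (417, 9, 20, 12, 1), (418, 11, 43, 5, 3), (419, 8, 6, 6, 2),
   (421, 8, 8, 4, 2), (422, 11, 47, 5, 3), (426, 9, 21, 11, 1), (427, 8, 23, 0, 1),
   (429, 8, 10, 9, 1), (430, 10, 38, 4, 2), (431, 8, 11, 8, 1), (461, 10, 20, 12, 2),
   (462, 7, 9, 1, 1), (463, 8, 21, 0, 1), (465, 9, 24, 8, 1), (466, 10, 40, 2, 2),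
   (467, 10, 26, 1, 3), (469, 14, 70, 26, 6), (470, 10, 36, 2, 2), (471, 7, 10, 0, 1),
   (473, 11, 38, 4, 3), (474, 9, 27, 7, 1), (478, 11, 53, 5, 3), (479, 10, 42, 2, 2),
   (481, 11, 52, 2, 3), (511, 11, 20, 16, 3), (514, 10, 32, 2, 2), (515, 11, 22, 14, 3),
   (517, 12, 20, 8, 8), (518, 9, 29, 5, 1), (519, 8, 19, 0, 1), (521, 10, 36, 0, 2),
   (523, 8, 9, 8, 1), (526, 10, 20, 10, 2), (527, 9, 24, 6, 1), (529, 8, 11, 6, 1),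
   (530, 14, 68, 10, 6), (533, 14, 74, 10, 6), (566, 11, 31, 5, 3), (569, 10, 26, 19, 1),
   (570, 7, 7, 1, 1), (571, 10, 24, 23, 1), (573, 9, 22, 6, 1), (574, 10, 26, 4, 2),
   (577, 7, 8, 0, 1), (578, 10, 48, 2, 2), (579, 6, 1, 0, 1), (581, 10, 26, 17, 1),
   (582, 12, 32, 30, 2), (583, 10, 21, 20, 1), (586, 12, 34, 28, 2), (587, 10, 28, 17, 1),
   (626, 9, 31, 1, 1), (627, 10, 31, 16, 1), (629, 10, 31, 14, 1), (631, 14, 77, 16, 5),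
   (633, 10, 30, 13, 1), (634, 13, 53, 19, 3), (635, 8, 8, 7, 1), (638, 16, 70, 44, 6),
   (641, 8, 10, 5, 1), (642, 9, 29, 1, 1), (643, 10, 24, 15, 1), (645, 10, 31, 18, 1),
   (685, 14, 62, 18, 4), (687, 10, 21, 16, 1), (689, 9, 36, 0, 1), (690, 9, 23, 3, 1),
   (691, 8, 15, 0, 1), (694, 7, 3, 3, 1), (695, 7, 4, 2, 1), (697, 11, 16, 14, 3),
   (698, 7, 5, 1, 1), (699, 12, 38, 18, 2), (701, 10, 23, 14, 1), (703, 7, 6, 0, 1),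
   (705, 9, 28, 0, 1), (749, 10, 12, 12, 2), (751, 10, 14, 10, 2), (753, 9, 20, 4, 1),
   (754, 13, 55, 11, 3), (755, 10, 31, 8, 1), (757, 10, 18, 17, 1), (758, 13, 43, 17, 3),
   (759, 9, 26, 0, 1), (761, 14, 56, 35, 3), (762, 9, 39, 1, 1), (763, 10, 20, 15, 1),
   (766, 13, 65, 19, 3), (767, 8, 8, 5, 1), (815, 9, 14, 8, 1), (817, 13, 68, 10, 3),
   (818, 11, 29, 25, 1), (821, 11, 26, 26, 1), (822, 9, 15, 7, 1), (823, 10, 36, 5, 1),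
   (826, 11, 29, 27, 1), (827, 14, 62, 25, 3), (829, 10, 39, 6, 1), (830, 11, 29, 23, 1),
   (831, 9, 16, 6, 1), (885, 11, 34, 18, 1), (886, 10, 20, 2, 2), (887, 9, 20, 2, 1),
   (889, 10, 38, 3, 1), (890, 11, 25, 23, 1), (893, 10, 23, 10, 1), (894, 12, 56, 6, 2),
   (895, 10, 36, 3, 1), (897, 12, 32, 16, 2), (898, 11, 27, 21, 1), (899, 10, 41, 4, 1),
   (901, 11, 30, 30, 1), (957, 9, 14, 6, 1), (958, 11, 39, 15, 1), (959, 11, 26, 20, 1),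
   (961, 10, 27, 6, 1), (962, 17, 75, 51, 5), (965, 10, 38, 1, 1), (966, 9, 15, 5, 1),
   (967, 10, 32, 3, 1), (969, 10, 18, 13, 1), (970, 11, 33, 15, 1), (971, 11, 22, 2, 3),
   (1031, 11, 32, 14, 1), (1033, 10, 45, 2, 1), (1034, 16, 80, 40, 4), (1037, 13, 30, 6, 5),
   (1038, 11, 25, 19, 1), (1039, 11, 42, 12, 1), (1041, 9, 20, 0, 1), (1042, 11, 39, 11, 1),
   (1043, 16, 96, 17, 5), (1045, 11, 26, 18, 1), (1109, 10, 47, 2, 1), (1110, 9, 13, 5, 1),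
   (1111, 14, 50, 34, 2), (1113, 10, 19, 10, 1), (1114, 11, 39, 9, 1), (1115, 14, 74, 7, 3),
   (1117, 14, 80, 17, 3), (1118, 14, 54, 36, 2), (1119, 10, 28, 3, 1), (1121, 14, 80, 11, 3),
   (1190, 11, 29, 13, 1), (1191, 10, 10, 6, 2), (1193, 12, 35, 26, 1), (1194, 15, 75, 21, 3),
   (1195, 16, 54, 38, 4), (1198, 11, 35, 9, 1), (1199, 12, 18, 6, 4), (1273, 16, 68, 43, 3),
   (1277, 11, 26, 14, 1), (1279, 14, 62, 22, 2), (1281, 9, 12, 4, 1), (1361, 13, 26, 16, 3),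
   (1362, 11, 31, 9, 1), (1363, 16, 65, 38, 3), (1365, 12, 42, 17, 1), (1451, 16, 86, 10, 4),
   (1541, 11, 22, 14, 1)]

def witnessesThree : List (ℕ × ℕ × ℕ × ℕ × ℕ) :=
  [(1, 1, 0, 0, 1), (2, 2, 2, 0, 2), (3, 2, 1, 0, 1), (5, 3, 2, 1, 1), (6, 4, 2, 4, 2),
   (7, 3, 0, 2, 1), (10, 4, 3, 3, 1), (11, 4, 1, 4, 1), (13, 4, 1, 2, 3), (14, 4, 6, 0, 2),
   (15, 3, 2, 0, 1), (17, 4, 8, 0, 2), (19, 3, 0, 1, 1), (21, 4, 4, 0, 2), (22, 4, 1, 1, 3),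
   (23, 5, 4, 5, 1), (26, 6, 6, 8, 2), (29, 5, 4, 4, 1), (30, 4, 3, 1, 1), (31, 4, 5, 0, 1),
   (34, 6, 10, 4, 2), (35, 4, 1, 2, 1), (37, 5, 8, 3, 1), (38, 4, 2, 0, 2), (41, 3, 0, 0, 1),
   (42, 6, 11, 1, 3), (43, 5, 0, 6, 1), (46, 8, 8, 12, 4), (47, 6, 5, 8, 1), (51, 5, 8, 1, 1),
   (55, 4, 3, 0, 1), (57, 8, 13, 10, 3), (58, 6, 9, 5, 1), (59, 6, 9, 6, 1), (62, 4, 1, 1, 1),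
   (65, 4, 0, 0, 2), (66, 6, 1, 9, 1), (67, 6, 9, 4, 1), (73, 5, 8, 0, 1), (74, 8, 19, 7, 3),
   (77, 8, 12, 12, 2), (78, 6, 11, 3, 1), (82, 6, 18, 0, 2), (83, 6, 7, 4, 1), (85, 8, 4, 16, 2),
   (86, 6, 9, 3, 1), (91, 7, 8, 9, 1), (93, 5, 0, 4, 1), (94, 6, 5, 1, 3), (95, 6, 11, 2, 1),
   (101, 7, 4, 11, 1), (102, 8, 14, 8, 2), (103, 5, 6, 0, 1), (105, 7, 12, 7, 1),
   (106, 6, 2, 4, 2), (111, 9, 10, 14, 3), (113, 10, 4, 26, 4), (114, 6, 7, 3, 1),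
   (115, 6, 9, 2, 1), (118, 6, 15, 1, 1), (122, 6, 11, 1, 1), (123, 7, 14, 7, 1),
   (127, 6, 4, 2, 2), (129, 7, 14, 5, 1), (137, 10, 19, 16, 3), (138, 10, 13, 19, 3),
   (139, 9, 14, 10, 3), (141, 8, 20, 4, 2), (142, 8, 22, 4, 2), (146, 10, 7, 23, 3),
   (149, 7, 16, 4, 1), (151, 8, 11, 12, 1), (161, 7, 10, 5, 1), (163, 7, 8, 6, 1),
   (165, 5, 2, 1, 1), (166, 8, 5, 15, 1), (167, 8, 13, 10, 1), (170, 8, 7, 13, 1),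
   (174, 8, 15, 11, 1), (177, 8, 8, 8, 2), (178, 8, 15, 9, 1), (179, 9, 32, 4, 3),
   (190, 8, 17, 9, 1), (191, 7, 16, 2, 1), (193, 9, 28, 2, 3), (194, 6, 1, 5, 1),
   (202, 8, 3, 15, 1), (203, 6, 9, 0, 1), (205, 7, 12, 3, 1), (206, 6, 7, 1, 1),
   (209, 8, 24, 0, 2), (218, 8, 19, 7, 1), (219, 7, 20, 1, 1), (221, 12, 28, 22, 4),
   (222, 8, 15, 7, 1), (223, 5, 2, 0, 1), (226, 10, 10, 20, 2), (230, 6, 3, 3, 1),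
   (235, 8, 17, 6, 1), (237, 9, 10, 18, 1), (238, 10, 12, 12, 4), (239, 9, 14, 16, 1),
   (251, 6, 1, 4, 1), (253, 9, 12, 19, 1), (254, 8, 19, 5, 1), (255, 7, 22, 0, 1),
   (258, 8, 21, 5, 1), (262, 8, 9, 9, 1), (266, 10, 30, 12, 2), (267, 6, 7, 0, 1),
   (269, 12, 23, 26, 3), (271, 9, 6, 19, 1), (273, 7, 16, 0, 1), (285, 9, 16, 12, 1),
   (286, 8, 10, 4, 2), (287, 8, 19, 4, 1), (289, 7, 24, 0, 1), (290, 10, 2, 24, 2),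
   (291, 8, 23, 4, 1), (298, 12, 25, 23, 3), (302, 12, 3, 31, 5), (303, 8, 13, 6, 1),
   (305, 9, 8, 16, 1), (307, 10, 0, 18, 4), (321, 9, 2, 21, 1), (322, 10, 34, 8, 2),
   (323, 8, 25, 4, 1), (326, 12, 31, 19, 3), (327, 8, 12, 2, 2), (330, 8, 19, 3, 1),
   (334, 14, 10, 44, 6), (338, 12, 37, 17, 3), (341, 10, 0, 24, 2), (345, 7, 0, 8, 1),
   (346, 10, 10, 16, 2), (361, 9, 24, 8, 1), (362, 8, 13, 5, 1), (363, 8, 15, 4, 1),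
   (365, 9, 18, 9, 1), (366, 10, 17, 19, 1), (370, 6, 3, 1, 1), (374, 8, 25, 1, 1),
   (381, 9, 26, 9, 1), (382, 12, 22, 28, 2), (383, 8, 19, 2, 1), (385, 7, 12, 0, 1),
   (401, 12, 24, 32, 2), (402, 8, 21, 1, 1), (403, 10, 15, 18, 1), (406, 10, 9, 27, 1),
   (410, 10, 13, 19, 1), (418, 8, 5, 9, 1), (422, 12, 18, 28, 2), (426, 8, 29, 1, 1),
   (427, 8, 23, 0, 1), (445, 11, 16, 14, 3), (446, 8, 19, 1, 1), (447, 8, 3, 10, 1),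
   (449, 9, 26, 5, 1), (454, 10, 3, 27, 1), (458, 10, 25, 13, 1), (462, 10, 23, 13, 1),
   (466, 16, 22, 56, 6), (467, 10, 7, 22, 1), (469, 9, 0, 19, 1), (470, 8, 7, 7, 1),
   (471, 7, 10, 0, 1), (491, 9, 26, 4, 1), (493, 8, 4, 4, 2), (494, 10, 13, 17, 1),
   (498, 10, 5, 23, 1), (502, 12, 14, 28, 2), (506, 10, 38, 0, 2), (510, 8, 17, 1, 1),
   (514, 12, 49, 7, 3), (515, 10, 1, 32, 1), (517, 9, 24, 4, 1), (537, 11, 20, 23, 1),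
   (538, 10, 15, 15, 1), (541, 13, 34, 20, 3), (542, 12, 42, 16, 2), (546, 10, 23, 11, 1),
   (554, 10, 31, 11, 1), (562, 12, 53, 5, 3), (563, 9, 22, 4, 1), (565, 9, 30, 2, 1),
   (587, 9, 34, 4, 1), (589, 12, 55, 4, 3), (590, 12, 6, 32, 2), (598, 10, 5, 21, 1),
   (602, 14, 31, 31, 3), (606, 10, 33, 11, 1), (610, 8, 11, 3, 1), (613, 9, 30, 1, 1),
   (614, 12, 30, 16, 2), (615, 8, 3, 8, 1), (641, 12, 48, 16, 2), (642, 10, 14, 8, 2),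
   (646, 12, 1, 29, 3), (654, 10, 33, 7, 1), (658, 10, 35, 9, 1), (662, 10, 19, 11, 1),
   (667, 9, 36, 1, 1), (694, 14, 12, 36, 4), (695, 9, 8, 10, 1), (698, 8, 13, 1, 1),
   (706, 10, 3, 21, 1), (710, 12, 49, 1, 3), (714, 8, 3, 7, 1), (718, 10, 11, 15, 1),
   (722, 10, 37, 7, 1), (754, 12, 21, 29, 1), (758, 10, 31, 5, 1), (762, 12, 25, 27, 1),
   (766, 12, 15, 35, 1), (770, 12, 27, 27, 1), (778, 14, 22, 40, 2), (814, 12, 15, 31, 1),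
   (818, 12, 31, 25, 1), (822, 8, 11, 1, 1), (826, 10, 10, 8, 2), (830, 12, 29, 23, 1),
   (834, 10, 37, 3, 1), (838, 10, 35, 3, 1), (870, 8, 7, 3, 1), (874, 12, 9, 35, 1),
   (878, 12, 33, 21, 1), (886, 10, 41, 3, 1), (890, 12, 25, 23, 1), (894, 12, 35, 21, 1),
   (898, 12, 21, 25, 1), (934, 12, 46, 4, 2), (938, 10, 25, 5, 1), (942, 10, 39, 1, 1),
   (946, 10, 17, 9, 1), (958, 12, 3, 41, 1), (962, 12, 11, 31, 1), (1002, 14, 58, 24, 2),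
   (1006, 16, 37, 43, 3), (1010, 12, 37, 17, 1), (1014, 12, 25, 21, 1), (1018, 10, 45, 3, 1),
   (1022, 12, 35, 17, 1), (1070, 12, 17, 25, 1), (1074, 10, 3, 17, 1), (1082, 14, 38, 24, 2),
   (1086, 12, 23, 7, 3), (1090, 12, 27, 19, 1), (1094, 10, 31, 1, 1), (1138, 10, 5, 15, 1),
   (1142, 12, 30, 8, 2), (1146, 12, 35, 15, 1), (1154, 14, 2, 48, 2), (1158, 10, 25, 3, 1),
   (1162, 12, 45, 17, 1), (1210, 8, 3, 3, 1), (1214, 10, 7, 13, 1), (1218, 14, 66, 16, 2),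
   (1222, 12, 9, 29, 1), (1226, 16, 55, 29, 3), (1230, 10, 13, 9, 1), (1234, 16, 79, 25, 3),
   (1286, 12, 23, 19, 1), (1290, 10, 27, 1, 1), (1294, 12, 45, 11, 1), (1298, 10, 19, 5, 1),
   (1302, 10, 9, 11, 1), (1306, 14, 70, 16, 2), (1362, 14, 58, 12, 2), (1366, 12, 39, 11, 1),
   (1370, 12, 7, 29, 1), (1374, 12, 29, 15, 1), (1378, 14, 46, 16, 2), (1382, 12, 25, 17, 1),
   (1438, 14, 27, 39, 1), (1442, 14, 37, 35, 1), (1446, 12, 43, 9, 1), (1454, 12, 51, 9, 1),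
   (1462, 14, 61, 1, 3), (1522, 14, 35, 33, 1), (1526, 14, 19, 43, 1), (1534, 12, 10, 16, 2),
   (1538, 12, 49, 7, 1), (1542, 14, 41, 31, 1), (1606, 14, 15, 45, 1), (1610, 12, 29, 13, 1),
   (1614, 14, 45, 29, 1), (1618, 12, 33, 11, 1), (1622, 12, 55, 7, 1), (1626, 12, 25, 15, 1),
   (1690, 12, 57, 7, 1), (1694, 12, 49, 5, 1), (1698, 10, 5, 11, 1), (1702, 12, 2, 20, 2),
   (1706, 12, 55, 5, 1), (1778, 12, 59, 7, 1), (1786, 12, 45, 5, 1), (1790, 16, 42, 36, 2),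
   (1794, 14, 51, 25, 1), (1866, 14, 62, 4, 2), (1870, 14, 20, 12, 4), (1874, 16, 37, 29, 3),
   (1878, 14, 51, 23, 1), (1882, 14, 10, 32, 2), (1958, 12, 41, 5, 1), (1966, 16, 10, 56, 2),
   (1970, 14, 19, 37, 1), (1974, 14, 57, 23, 1), (2054, 18, 124, 16, 4), (2062, 12, 51, 1, 1),
   (2066, 12, 5, 25, 1), (2154, 12, 19, 15, 1), (2158, 14, 45, 21, 1), (2162, 10, 7, 7, 1),
   (2258, 14, 62, 0, 2), (2262, 16, 78, 16, 2), (2354, 12, 11, 19, 1), (2454, 18, 93, 21, 3),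
   (2458, 16, 35, 51, 1), (2462, 16, 49, 49, 1), (2558, 10, 7, 5, 1), (2562, 10, 1, 9, 1),
   (2566, 18, 103, 17, 3), (2666, 16, 25, 55, 1), (2670, 14, 45, 17, 1), (2774, 14, 19, 31, 1),
   (2778, 16, 45, 41, 1), (2886, 14, 57, 11, 1), (2890, 14, 22, 16, 2), (3002, 12, 25, 7, 1)]

theorem small_cases_two : (List.range 1542).all
    (smallCheck 2 8 69 witnessesTwo fun _ s => Nat.beq (s % 2) 0) = true := by
  decide +kernel

theorem small_cases_three : (List.range 3118).all
    (smallCheck 3 13 109 witnessesThree fun k s => Nat.beq (k % 2) 1 || Nat.beq (s % 2) 0) =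
      true := by
  decide +kernel

theorem Squarefree.not_mul_self_mod_eq_zero {k p : ℕ} (hk : Squarefree k) (hp : p ≠ 1) :
    k % (p * p) ≠ 0 := fun h => hp (Nat.isUnit_iff.1 (hk p (Nat.dvd_of_mod_eq_zero h)))

theorem Squarefree.mod_small_squares {k : ℕ} (hk : Squarefree k) :
    ¬ (k % 4 = 0 ∨ k % 9 = 0 ∨ k % 25 = 0 ∨ k % 49 = 0) := by
  have h2 := hk.not_mul_self_mod_eq_zero (p := 2) (by norm_num)
  have h3 := hk.not_mul_self_mod_eq_zero (p := 3) (by norm_num)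
  have h5 := hk.not_mul_self_mod_eq_zero (p := 5) (by norm_num)
  have h7 := hk.not_mul_self_mod_eq_zero (p := 7) (by norm_num)
  omega

theorem exists_rep_two_of_squarefree {k : ℕ} (hk : Squarefree k) :
    ∃ s x y z w : ℕ, 0 < s ∧ k ^ 2 = x ^ 2 + y ^ 2 + z ^ 2 + w ^ 2 ∧
      x + 2 * y + 2 * z = s ^ 2 := by
  have hmod := hk.mod_small_squares
  have h4 : ¬ 4 ∣ k := by omega
  have hpos : 0 < k := Nat.pos_of_ne_zero hk.ne_zero
  have of_between (t : ℕ) (h1 : 8 * k ^ 2 ≤ (2 * t) ^ 4) (h2 : (2 * t) ^ 4 ≤ 9 * k ^ 2) :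
      ∃ s x y z w : ℕ, 0 < s ∧ k ^ 2 = x ^ 2 + y ^ 2 + z ^ 2 + w ^ 2 ∧
        x + 2 * y + 2 * z = s ^ 2 := by
    obtain ⟨x, y, z, w, h⟩ := exists_nat_rep_two h4 h1 h2
    refine ⟨2 * t, x, y, z, w, Nat.pos_of_ne_zero fun h0 => ?_, h⟩
    rw [h0] at h1
    have : 0 < k ^ 2 := by positivity
    omega
  rcases lt_or_ge k 1542 with hlt | hge
  · rcases smallCheck_spec (List.all_eq_true.1 small_cases_two k (List.mem_range.2 hlt)) with
      h | ⟨s, hs, h1, h2⟩ | ⟨e, he⟩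
    · exact absurd h hmod
    · obtain ⟨t, rfl⟩ := Nat.dvd_of_mod_eq_zero (Nat.eq_of_beq_eq_true hs)
      exact of_between t h1 h2
    · exact exists_rep_of_isWitness he
  · obtain ⟨t, h1, h2⟩ := exists_two_mul_pow_four_between (M := 8) (N := 9) (c := 34) (k := k)
      (by norm_num) (by norm_num) (fun t ht => by
        obtain ⟨r, rfl⟩ := Nat.exists_eq_add_of_le ht
        ring_nf
        omega) (by nlinarith)
    exact of_between t h1 h2

theorem exists_rep_three_of_squarefree {k : ℕ} (hk : Squarefree k) :
    ∃ s x y z w : ℕ, 0 < s ∧ k ^ 2 = x ^ 2 + y ^ 2 + z ^ 2 + w ^ 2 ∧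
      x + 2 * y + 3 * z = s ^ 2 := by
  have hmod := hk.mod_small_squares
  have h4 : ¬ 4 ∣ k := by omega
  have hpos : 0 < k := Nat.pos_of_ne_zero hk.ne_zero
  have of_between (s : ℕ) (hs : k % 2 = 1 ∨ s % 2 = 0) (h1 : 13 * k ^ 2 ≤ s ^ 4)
      (h2 : s ^ 4 ≤ 14 * k ^ 2) :
      ∃ s x y z w : ℕ, 0 < s ∧ k ^ 2 = x ^ 2 + y ^ 2 + z ^ 2 + w ^ 2 ∧
        x + 2 * y + 3 * z = s ^ 2 := by
    obtain ⟨x, y, z, w, h⟩ := exists_nat_rep_three h4 (by omega) h1 h2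
    refine ⟨s, x, y, z, w, Nat.pos_of_ne_zero fun h0 => ?_, h⟩
    rw [h0] at h1
    have : 0 < k ^ 2 := by positivity
    omega
  rcases lt_or_ge k 3118 with hlt | hge
  · rcases smallCheck_spec (List.all_eq_true.1 small_cases_three k (List.mem_range.2 hlt)) with
      h | ⟨s, hs, h1, h2⟩ | ⟨e, he⟩
    · exact absurd h hmod
    · exact of_between s (by simpa [Nat.beq_eq] using hs) h1 h2
    · exact exists_rep_of_isWitness he
  · obtain ⟨t, h1, h2⟩ := exists_two_mul_pow_four_between (M := 13) (N := 14) (c := 54) (k := k)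
      (by norm_num) (by norm_num) (fun t ht => by
        obtain ⟨r, rfl⟩ := Nat.exists_eq_add_of_le ht
        ring_nf
        omega) (by nlinarith)
    exact of_between (2 * t) (by omega) h1 h2

theorem corollary1p1 (lam : ℕ) (hlam : lam = 2 ∨ lam = 3) (m : ℕ) (hm : 0 < m) (hsq : IsSquare m) :
    ∃ x y z w : ℕ, m = x ^ 2 + y ^ 2 + z ^ 2 + w ^ 2 ∧
      0 < x + 2 * y + lam * z ∧ IsSquare (x + 2 * y + lam * z) := by
  obtain ⟨n, rfl⟩ := hsq
  obtain ⟨k, c, rfl, hk⟩ := Nat.sq_mul_squarefree n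
  have hc : 0 < c := Nat.pos_of_ne_zero (by rintro rfl; simp at hm)
  have hrep : ∃ s x y z w : ℕ, 0 < s ∧ k ^ 2 = x ^ 2 + y ^ 2 + z ^ 2 + w ^ 2 ∧
      x + 2 * y + lam * z = s ^ 2 := by
    rcases hlam with rfl | rfl
    · exact exists_rep_two_of_squarefree hk
    · exact exists_rep_three_of_squarefree hk
  obtain ⟨s, x, y, z, w, hs, hsum, hlin⟩ := hrep
  have hlin' : c ^ 2 * x + 2 * (c ^ 2 * y) + lam * (c ^ 2 * z) = (c * s) * (c * s) := by
    linear_combination c ^ 2 * hlin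
  refine ⟨c ^ 2 * x, c ^ 2 * y, c ^ 2 * z, c ^ 2 * w, by linear_combination c ^ 4 * hsum, ?_, ?_⟩
  · rw [hlin']; positivity
  · exact ⟨c * s, hlin'⟩
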